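/- **Setting.** Let $f:\operatorname{dom} f\subseteq\mathbb{R}^n\to\mathbb{R}$ be a $\nu$-self-concordant barrier with $\nu>0$. That is, $\operatorname{dom} f$ is open and convex; $f$ is convex, closed (closed epigraph) and $C^3$ on $\operatorname{dom} f$; for all $x\in\operatorname{dom} f$ and $v\in\mathbb{R}^n$ the function $\varphi(\tau)=f(x+\tau v)$ satisfies $|\varphi'''(\tau)|\le 2\varphi''(\tau)^{3/2}$ whenever $x+\tau v\in\operatorname{dom} f$; and $\sup_{u}\{2\nabla f(x)^Tu-u^T\nabla^2 f(x)u\}\le\nu$ for all $x\in\operatorname{dom} f$. Let $g:\mathbb{R}^n\to\mathbb{R}\cup\{+\infty\}$ be proper, lower semicontinuous and convex, and let $t>0$. Put $\operatorname{dom} F=\operatorname{dom} f\cap\operatorname{dom} g$ and $F(x;t)=f(x)+t^{-1}g(x)$. Let $x_t^*\in\operatorname{dom} F$ be a minimizer of $F(\cdot\,;t)$ with $\nabla^2 f(x_t^*)\succ 0$, and write $\|u\|_{x_t^*}=(u^T\nabla^2 f(x_t^*)u)^{1/2}$. For $z\in\operatorname{dom} F$ let $$\widehat F(x;t,z)=f(z)+\nabla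 f(z)^T(x-z)+\tfrac12(x-z)^T\nabla^2 f(z)(x-z)+t^{-1}g(x).$$ Let $x_t^0\in\operatorname{dom} F$, let $\delta_j\ge 0$ for $j\ge0$, and let $(x_t^j)_{j\ge 0}$ be inexact full-step proximal-Newton iterates: for every $j\ge 0$, $x_t^{j+1}\in\operatorname{dom} F$ is a $\delta_j$-solution of $\min_{x\in\operatorname{dom} F}\widehat F(x;t,x_t^j)$, i.e. $$\widehat F(x_t^{j+1};t,x_t^j)-\inf_{y\in\operatorname{dom} F}\widehat F(y;t,x_t^j)\le \delta_j^2/2 .$$ Put $\lambda_t^j=\|x_t^j-x_t^*\|_{x_t^*}$. **Corollary 3.3.** (a) There is an absolute constant $q\in[0,1)$ such that the following holds. If $\delta_j\le 0.15\,\lambda_t^j$ for all $j\ge0$ and $\lambda_t^0\le 0.1427$, then $x_t^j\to x_t^*$ at a linear rate in the local norm: $\lambda_t^j\to0$ and $\lambda_t^{j+1}\le q\,\lambda_t^j$ for all $j\ge 0$. (b) Let $c>0$. If $\delta_j\le c\,(\lambda_t^j)^2$ for all $j\ge0$ and $\lambda_t^0\le\min\{0.15,(1.177c+6.068)^{-1}\}$,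 then $x_t^j\to x_t^*$ at a quadratic rate in the local norm: $\lambda_t^j\to 0$ and $\lambda_t^{j+1}\le(1.177c+6.068)\,(\lambda_t^j)^2$ for all $j\ge 0$. -/

import Mathlib

namespace ProxNewton

/-- Standard self-concordance of a function of one real variable on the (open) set `I`:
convex, three times continuously differentiable, and `|φ'''| ≤ 2 (φ'')^(3/2)` on `I`. -/
structure IsStandardSelfConcordantOn (φ : ℝ → ℝ) (I : Set ℝ) : Prop where
  convexOn : ConvexOn ℝ I φ
  contDiffOn : ContDiffOn ℝ 3 φ I
  bound : ∀ τ ∈ I, |iteratedDeriv 3 φ τ| ≤ 2 * (iteratedDeriv 2 φ τ) ^ (3 / 2 : ℝ)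

/-- `f : D ⊆ ℝⁿ → ℝ`, with `D = dom f`, is (standard) self-concordant: `D` is open, `f` is a closed
convex `C³` function on `D`, and every restriction of `f` to a line is standard self-concordant.
The values of `f` outside `D` play no role (there `f = +∞`). -/
structure IsSelfConcordant {n : ℕ} (D : Set (EuclideanSpace ℝ (Fin n)))
    (f : EuclideanSpace ℝ (Fin n) → ℝ) : Prop where
  isOpen : IsOpen D
  convexOn : ConvexOn ℝ D f
  contDiffOn : ContDiffOn ℝ 3 f D
  /-- The epigraph of `f` is closed, i.e. `f`, extended by `+∞`, is lower semicontinuous. -/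
  closed_epigraph : IsClosed {p : EuclideanSpace ℝ (Fin n) × ℝ | p.1 ∈ D ∧ f p.1 ≤ p.2}
  line : ∀ x ∈ D, ∀ v : EuclideanSpace ℝ (Fin n),
    IsStandardSelfConcordantOn (fun τ : ℝ => f (x + τ • v)) {τ : ℝ | x + τ • v ∈ D}

/-- The Hessian of `f` at `x` as a bilinear form: `hess f x u v = uᵀ ∇²f(x) v`. -/
noncomputable def hess {n : ℕ} (f : EuclideanSpace ℝ (Fin n) → ℝ)
    (x : EuclideanSpace ℝ (Fin n)) :
    EuclideanSpace ℝ (Fin n) →L[ℝ] EuclideanSpace ℝ (Fin n) →L[ℝ] ℝ :=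
  fderiv ℝ (fderiv ℝ f) x

/-- The local norm `‖u‖_x = (uᵀ ∇²f(x) u)^(1/2)`. -/
noncomputable def localNorm {n : ℕ} (f : EuclideanSpace ℝ (Fin n) → ℝ)
    (x u : EuclideanSpace ℝ (Fin n)) : ℝ :=
  Real.sqrt (hess f x u u)

/-- `f`, with domain `D`, is a `ν`-self-concordant barrier for the closure of `D`:
it is self-concordant, `ν > 0`, and `sup_u {2 ∇f(x)ᵀu - ‖u‖_x²} ≤ ν` for every `x ∈ D`
(here `fderiv ℝ f x u` is `∇f(x)ᵀu`). -/
structure IsSelfConcordantBarrier {n : ℕ} (D : Set (EuclideanSpace ℝ (Fin n)))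
    (f : EuclideanSpace ℝ (Fin n) → ℝ) (ν : ℝ) : Prop where
  selfConcordant : IsSelfConcordant D f
  pos : 0 < ν
  bound : ∀ x ∈ D, ∀ u : EuclideanSpace ℝ (Fin n),
    2 * fderiv ℝ f x u - localNorm f x u ^ 2 ≤ ν

/-- `g : ℝⁿ → ℝ ∪ {+∞}` is proper, lower semicontinuous and convex (its epigraph is convex). -/
structure IsProperLscConvex {n : ℕ} (g : EuclideanSpace ℝ (Fin n) → EReal) : Prop where
  ne_bot : ∀ x, g x ≠ ⊥
  exists_ne_top : ∃ x, g x ≠ ⊤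
  lsc : LowerSemicontinuous g
  convex : Convex ℝ {p : EuclideanSpace ℝ (Fin n) × ℝ | g p.1 ≤ (p.2 : EReal)}

/-- `dom F = dom f ∩ dom g`, with `D = dom f` and `dom g = {x | g x < +∞}`. -/
def domF {n : ℕ} (D : Set (EuclideanSpace ℝ (Fin n)))
    (g : EuclideanSpace ℝ (Fin n) → EReal) : Set (EuclideanSpace ℝ (Fin n)) :=
  {x | x ∈ D ∧ g x < ⊤}

/-- The composite objective `F(x; t) = f(x) + t⁻¹ g(x)`. It is used only at points of `dom F`, where
`g` is finite; elsewhere the true value is `+∞`. -/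
noncomputable def F {n : ℕ} (f : EuclideanSpace ℝ (Fin n) → ℝ)
    (g : EuclideanSpace ℝ (Fin n) → EReal) (t : ℝ) (x : EuclideanSpace ℝ (Fin n)) : ℝ :=
  f x + t⁻¹ * (g x).toReal

/-- The second-order model `Q(x; z)` of `f` around `z`. -/
noncomputable def Q {n : ℕ} (f : EuclideanSpace ℝ (Fin n) → ℝ)
    (z x : EuclideanSpace ℝ (Fin n)) : ℝ :=
  f z + fderiv ℝ f z (x - z) + (1 / 2) * hess f z (x - z) (x - z)

/-- The composite quadratic model `F̂(x; t, z) = Q(x; z) + t⁻¹ g(x)`, used only on `dom F`. -/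
noncomputable def Fhat {n : ℕ} (f : EuclideanSpace ℝ (Fin n) → ℝ)
    (g : EuclideanSpace ℝ (Fin n) → EReal) (t : ℝ) (z x : EuclideanSpace ℝ (Fin n)) : ℝ :=
  Q f z x + t⁻¹ * (g x).toReal

/-- `x` is a solution of `min F(·; t)`; a solution lies in `dom F`. -/
def IsSolution {n : ℕ} (D : Set (EuclideanSpace ℝ (Fin n)))
    (f : EuclideanSpace ℝ (Fin n) → ℝ) (g : EuclideanSpace ℝ (Fin n) → EReal) (t : ℝ)
    (x : EuclideanSpace ℝ (Fin n)) : Prop :=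
  x ∈ domF D g ∧ IsMinOn (F f g t) (domF D g) x

/-- `x` is a `δ`-solution of the subproblem `min {F̂(y; t, z) | y ∈ dom F}`: it lies in `dom F` and
its model value exceeds the minimum of the model over `dom F` by at most `δ² / 2`. The existence of
an exact minimizer is not presupposed. -/
def IsDeltaSolution {n : ℕ} (D : Set (EuclideanSpace ℝ (Fin n)))
    (f : EuclideanSpace ℝ (Fin n) → ℝ) (g : EuclideanSpace ℝ (Fin n) → EReal) (t : ℝ)
    (z : EuclideanSpace ℝ (Fin n)) (δ : ℝ) (x : EuclideanSpace ℝ (Fin n)) : Prop :=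
  x ∈ domF D g ∧ ∀ y ∈ domF D g, Fhat f g t z x - Fhat f g t z y ≤ δ ^ 2 / 2

end ProxNewton

/-! Self-concordance says that `1 / √φ''` is 1-Lipschitz along lines, and Banach's theorem on
symmetric trilinear forms upgrades the bound on `D³f(x)[v, v, v]` to
`|D³f(x)[u, v, v]| ≤ 2 ‖u‖_x ‖v‖_x²`. Hence the local norms at two points `x*` and `z` with
`λ = ‖z - x*‖_{x*} < 1` agree up to the factor `1 - λ`, and the linearization error of the gradient
satisfies `|(∇f(z) - ∇f(x*) - ∇²f(z)(z - x*))ᵀd| ≤ λ² ‖d‖_{x*} / (1 - λ)²`.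

A proximal-Newton step from `z` to `x` is tested against the points of the segment from `x` to `x*`.
Together with the first-order optimality of `x*` this gives `‖x - x*‖_z ≤ λ² / (1 - λ)³ + δ`, and
returning to the local norm at `x*` yields the recursion `λ₊ ≤ λ² / (1 - λ)⁴ + δ / (1 - λ)`. -/

namespace ProxNewton

open Set Filter Topology

section SymmetricTrilinearForms

/-- The binary cubic form `A a³ + 3 B a² b + 3 C a b² + E b³`: the restriction of a symmetric
trilinear form to the diagonal of a plane, in coordinates `(a, b)`. -/
noncomputable def binaryCubic (A B C E a b : ℝ) : ℝ :=
  a ^ 3 * A + 3 * a ^ 2 * b * B + 3 * a * b ^ 2 * C + b ^ 3 * E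

/-- The weight `((1 + 2 cos 2θ) / 3)²` of the node `(a, b) = (cos θ, sin θ)` in M. Riesz's
interpolation formula for cubic trigonometric polynomials. -/
noncomputable def rieszWeight (a b : ℝ) : ℝ :=
  (a ^ 2 - b ^ 2 / 3) ^ 2

-- With `(c, s) = (cos τ, sin τ)` and `r = √3`, the nodes are at the angles `τ + 2πk/3` and the
-- coefficients on the left are `cos 3τ` and `sin 3τ`.
theorem riesz_interpolation {c s r : ℝ} (hcs : c ^ 2 + s ^ 2 = 1) (hr : r ^ 2 = 3)
    (A B C E : ℝ) :
    (4 * c ^ 3 - 3 * c) * A + (3 * s - 4 * s ^ 3) * B =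
      rieszWeight c s * binaryCubic A B C E c s +
      rieszWeight (-c / 2 - r * s / 2) (-s / 2 + r * c / 2) *
        binaryCubic A B C E (-c / 2 - r * s / 2) (-s / 2 + r * c / 2) +
      rieszWeight (-c / 2 + r * s / 2) (-s / 2 - r * c / 2) *
        binaryCubic A B C E (-c / 2 + r * s / 2) (-s / 2 - r * c / 2) := by
  have hr4 : r ^ 4 = 9 := by rw [show r ^ 4 = (r ^ 2) ^ 2 by ring, hr]; norm_num
  have hr6 : r ^ 6 = 27 := by rw [show r ^ 6 = (r ^ 2) ^ 3 by ring, hr]; norm_num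
  have homogenize : (4 * c ^ 3 - 3 * c) * A + (3 * s - 4 * s ^ 3) * B =
      (c ^ 2 + s ^ 2) ^ 2 * ((c ^ 3 - 3 * c * s ^ 2) * A + (3 * c ^ 2 * s - s ^ 3) * B) := by
    rw [hcs]; linear_combination (3 * c * A - 3 * s * B) * hcs
  rw [homogenize]
  unfold rieszWeight binaryCubic
  ring_nf
  simp only [hr, hr4, hr6]
  ring

theorem rieszWeight_sum {c s r : ℝ} (hcs : c ^ 2 + s ^ 2 = 1) (hr : r ^ 2 = 3) :
    rieszWeight c s + rieszWeight (-c / 2 - r * s / 2) (-s / 2 + r * c / 2) +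
      rieszWeight (-c / 2 + r * s / 2) (-s / 2 - r * c / 2) = 1 := by
  have hr4 : r ^ 4 = 9 := by rw [show r ^ 4 = (r ^ 2) ^ 2 by ring, hr]; norm_num
  have homogenize : (1 : ℝ) = (c ^ 2 + s ^ 2) ^ 2 := by rw [hcs, one_pow]
  rw [homogenize]
  unfold rieszWeight
  ring_nf
  simp only [hr, hr4]
  ring

-- The Bernstein–Szegő inequality at `0` for the trigonometric polynomial
-- `τ ↦ binaryCubic A B C E (cos τ) (sin τ)`, whose value and derivative there are `A` and `3 B`.
theorem abs_cos_mul_add_sin_mul_le_of_abs_binaryCubic_le {A B C E M : ℝ}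
    (hM : ∀ a b, a ^ 2 + b ^ 2 = 1 → |binaryCubic A B C E a b| ≤ M) (θ : ℝ) :
    |Real.cos θ * A + Real.sin θ * B| ≤ M := by
  obtain ⟨c, hc⟩ : ∃ c, c = Real.cos (θ / 3) := ⟨_, rfl⟩
  obtain ⟨s, hs⟩ : ∃ s, s = Real.sin (θ / 3) := ⟨_, rfl⟩
  obtain ⟨r, hr⟩ : ∃ r : ℝ, r ^ 2 = 3 := ⟨√3, Real.sq_sqrt (by norm_num)⟩
  have hcs : c ^ 2 + s ^ 2 = 1 := by rw [hc, hs, Real.cos_sq_add_sin_sq]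
  have hcos : Real.cos θ = 4 * c ^ 3 - 3 * c := by rw [hc, ← Real.cos_three_mul]; ring_nf
  have hsin : Real.sin θ = 3 * s - 4 * s ^ 3 := by rw [hs, ← Real.sin_three_mul]; ring_nf
  have weighted : ∀ a b, a ^ 2 + b ^ 2 = 1 →
      |rieszWeight a b * binaryCubic A B C E a b| ≤ rieszWeight a b * M := fun a b hab => by
    have hw : 0 ≤ rieszWeight a b := sq_nonneg _
    rw [abs_mul, abs_of_nonneg hw]
    exact mul_le_mul_of_nonneg_left (hM a b hab) hw
  rw [hcos, hsin, riesz_interpolation hcs hr A B C E]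
  refine (abs_add_three _ _ _).trans ((add_le_add_three (weighted _ _ hcs)
    (weighted _ _ ?_) (weighted _ _ ?_)).trans_eq ?_)
  · linear_combination (1 / 4 + r ^ 2 / 4) * hcs + hr / 4
  · linear_combination (1 / 4 + r ^ 2 / 4) * hcs + hr / 4
  · rw [← add_mul, ← add_mul, rieszWeight_sum hcs hr, one_mul]

variable {V : Type*} [AddCommGroup V] [Module ℝ V] {T : V →ₗ[ℝ] V →ₗ[ℝ] V →ₗ[ℝ] ℝ}
  {B : LinearMap.BilinForm ℝ V} {M : ℝ}

/-- A trilinear form that is invariant under all permutations of its arguments; the two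
transpositions below generate them. -/
structure IsSymmTrilinear (T : V →ₗ[ℝ] V →ₗ[ℝ] V →ₗ[ℝ] ℝ) : Prop where
  swap_left : ∀ u v w, T u v w = T v u w
  swap_right : ∀ u v w, T u v w = T u w v

theorem IsSymmTrilinear.apply_diag_eq_binaryCubic (hT : IsSymmTrilinear T) (e₁ e₂ : V) (a b : ℝ) :
    T (a • e₁ + b • e₂) (a • e₁ + b • e₂) (a • e₁ + b • e₂) =
      binaryCubic (T e₁ e₁ e₁) (T e₂ e₁ e₁) (T e₂ e₂ e₁) (T e₂ e₂ e₂) a b := by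
  have h112 : T e₁ e₁ e₂ = T e₂ e₁ e₁ := by rw [hT.swap_right, hT.swap_left]
  have h121 : T e₁ e₂ e₁ = T e₂ e₁ e₁ := hT.swap_left _ _ _
  have h122 : T e₁ e₂ e₂ = T e₂ e₂ e₁ := by rw [hT.swap_left, hT.swap_right]
  have h212 : T e₂ e₁ e₂ = T e₂ e₂ e₁ := hT.swap_right _ _ _
  simp only [binaryCubic, map_add, map_smul, LinearMap.add_apply, LinearMap.smul_apply,
    smul_eq_mul, h112, h121, h122, h212]
  ring

theorem IsSymmTrilinear.abs_apply_le_of_orthogonal (hT : IsSymmTrilinear T) (hB : B.IsSymm)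
    (hM : ∀ w, B w w ≤ 1 → |T w w w| ≤ M) {e₁ e₂ : V} (he₁ : B e₁ e₁ ≤ 1) (he₂ : B e₂ e₂ ≤ 1)
    (horth : B e₁ e₂ = 0) (θ : ℝ) :
    |T (Real.cos θ • e₁ + Real.sin θ • e₂) e₁ e₁| ≤ M := by
  have horth' : B e₂ e₁ = 0 := by rw [← hB.eq, horth]
  simp only [map_add, map_smul, LinearMap.add_apply, LinearMap.smul_apply, smul_eq_mul]
  refine abs_cos_mul_add_sin_mul_le_of_abs_binaryCubic_le
    (C := T e₂ e₂ e₁) (E := T e₂ e₂ e₂) (fun a b hab => ?_) θ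
  rw [← hT.apply_diag_eq_binaryCubic]
  refine hM _ ?_
  simp only [map_add, map_smul, LinearMap.add_apply, LinearMap.smul_apply, smul_eq_mul, horth,
    horth']
  nlinarith [mul_le_mul_of_nonneg_left he₁ (sq_nonneg a),
    mul_le_mul_of_nonneg_left he₂ (sq_nonneg b)]

theorem IsSymmTrilinear.abs_apply_le_of_unit (hT : IsSymmTrilinear T) (hB : B.IsPosSemidef)
    (hM : ∀ w, B w w ≤ 1 → |T w w w| ≤ M) {u v : V} (hu : B u u < 1) (hv : B v v = 1) :
    |T u v v| ≤ M := by
  obtain ⟨ρ, hρ⟩ : ∃ ρ, B v u = ρ := ⟨_, rfl⟩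
  have hρ' : B u v = ρ := by rw [← hB.eq, hρ]
  have hρ_sq : ρ ^ 2 < 1 := by
    have h := B.apply_sq_le_of_symm hB.nonneg ⟨hB.isSymm.eq⟩ v u
    rw [hv, hρ, one_mul] at h
    exact h.trans_lt hu
  obtain ⟨hρ_lo, hρ_hi⟩ := abs_le.1 ((sq_lt_one_iff_abs_lt_one ρ).1 hρ_sq).le
  have hσ : 0 < √(1 - ρ ^ 2) := Real.sqrt_pos.2 (sub_pos.2 hρ_sq)
  have hnorm : B ((√(1 - ρ ^ 2))⁻¹ • (u - ρ • v)) ((√(1 - ρ ^ 2))⁻¹ • (u - ρ • v)) ≤ 1 := by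
    have hresidual : B (u - ρ • v) (u - ρ • v) ≤ √(1 - ρ ^ 2) ^ 2 := by
      rw [Real.sq_sqrt (sub_pos.2 hρ_sq).le]
      simp only [map_sub, map_smul, LinearMap.sub_apply, LinearMap.smul_apply, smul_eq_mul, hv,
        hρ, hρ']
      linarith
    simp only [map_smul, LinearMap.smul_apply, smul_eq_mul]
    rw [← mul_assoc, ← mul_inv, ← sq]
    exact inv_mul_le_one_of_le₀ hresidual (sq_nonneg _)
  have horth : B v ((√(1 - ρ ^ 2))⁻¹ • (u - ρ • v)) = 0 := by simp [hv, hρ]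
  have h := hT.abs_apply_le_of_orthogonal hB.isSymm hM hv.le hnorm horth (Real.arccos ρ)
  rwa [Real.cos_arccos hρ_lo hρ_hi, Real.sin_arccos, smul_inv_smul₀ hσ.ne', add_sub_cancel] at h

theorem IsSymmTrilinear.abs_apply_le_of_lt_one (hT : IsSymmTrilinear T) (hB : B.IsPosSemidef)
    (hM : ∀ w, B w w ≤ 1 → |T w w w| ≤ M) {u v : V} (hu : B u u < 1) (hv : B v v ≤ 1) :
    |T u v v| ≤ M := by
  rcases (hB.nonneg v).eq_or_lt with hv_zero | hv_pos
  · have horth : B v u = 0 := by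
      have h := B.apply_sq_le_of_symm hB.nonneg ⟨hB.isSymm.eq⟩ v u
      rw [← hv_zero, zero_mul] at h
      exact pow_eq_zero_iff two_ne_zero |>.1 (h.antisymm (sq_nonneg _))
    simpa using hT.abs_apply_le_of_orthogonal hB.isSymm hM hv hu.le horth (Real.pi / 2)
  · have hunit : B ((√(B v v))⁻¹ • v) ((√(B v v))⁻¹ • v) = 1 := by
      simp only [map_smul, LinearMap.smul_apply, smul_eq_mul]
      rw [← mul_assoc, ← mul_inv, Real.mul_self_sqrt hv_pos.le, inv_mul_cancel₀ hv_pos.ne']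
    have h := hT.abs_apply_le_of_unit hB hM hu hunit
    simp only [map_smul, LinearMap.smul_apply, smul_eq_mul] at h
    rw [← mul_assoc, ← mul_inv, Real.mul_self_sqrt hv_pos.le, abs_mul, abs_inv,
      abs_of_pos hv_pos, inv_mul_le_iff₀ hv_pos] at h
    exact h.trans (mul_le_of_le_one_left ((abs_nonneg _).trans (hM 0 (by simp))) hv)

-- Banach's theorem on symmetric multilinear forms, in degree three: the diagonal bound extends to
-- mixed arguments without loss in the constant.
theorem IsSymmTrilinear.abs_apply_le (hT : IsSymmTrilinear T) (hB : B.IsPosSemidef) (hM0 : 0 ≤ M)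
    (hM : ∀ w, |T w w w| ≤ M * √(B w w) ^ 3) (u v : V) :
    |T u v v| ≤ M * √(B u u) * B v v := by
  have hM' : ∀ w, B w w ≤ 1 → |T w w w| ≤ M := fun w hw =>
    (hM w).trans (mul_le_of_le_one_right hM0 (pow_le_one₀ (Real.sqrt_nonneg _)
      (Real.sqrt_le_one.2 hw)))
  have hscaled : ∀ w, ∀ ε > 0,
      B ((√(B w w) + ε)⁻¹ • w) ((√(B w w) + ε)⁻¹ • w) < 1 := fun w ε hε => by
    have hpos : 0 < √(B w w) + ε := by positivity
    simp only [map_smul, LinearMap.smul_apply, smul_eq_mul]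
    rw [← mul_assoc, ← mul_inv, ← sq, inv_mul_lt_one₀ (by positivity)]
    exact (Real.sqrt_lt' hpos).1 (lt_add_of_pos_right _ hε)
  have hε : ∀ ε > 0, |T u v v| ≤ M * (√(B u u) + ε) * (√(B v v) + ε) ^ 2 := fun ε hε => by
    have ha : 0 < √(B u u) + ε := by positivity
    have hb : 0 < √(B v v) + ε := by positivity
    have h := hT.abs_apply_le_of_lt_one hB hM' (hscaled u ε hε) (hscaled v ε hε).le
    simp only [map_smul, LinearMap.smul_apply, smul_eq_mul, abs_mul, abs_inv, abs_of_pos ha,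
      abs_of_pos hb] at h
    calc |T u v v| = (√(B v v) + ε)⁻¹ * ((√(B v v) + ε)⁻¹ * ((√(B u u) + ε)⁻¹ * |T u v v|)) *
          ((√(B u u) + ε) * (√(B v v) + ε) ^ 2) := by field_simp
      _ ≤ M * ((√(B u u) + ε) * (√(B v v) + ε) ^ 2) := by gcongr
      _ = M * (√(B u u) + ε) * (√(B v v) + ε) ^ 2 := by ring
  have hcont : Continuous fun ε : ℝ => M * (√(B u u) + ε) * (√(B v v) + ε) ^ 2 := by fun_prop
  have hlim := (hcont.tendsto 0).mono_left (nhdsWithin_le_nhds (s := Ioi 0))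
  simp only [add_zero, Real.sq_sqrt (hB.nonneg v)] at hlim
  exact ge_of_tendsto hlim (eventually_of_mem self_mem_nhdsWithin hε)

end SymmetricTrilinearForms

section DifferentialInequalities

theorem norm_sub_le_of_norm_deriv_le {E : Type*} [NormedAddCommGroup E] [NormedSpace ℝ E]
    {φ φ' : ℝ → E} {β β' : ℝ → ℝ} {a b : ℝ} (hφ : ∀ s ∈ Icc a b, HasDerivAt φ (φ' s) s)
    (hβ : ∀ s ∈ Icc a b, HasDerivAt β (β' s) s) (hle : ∀ s ∈ Icc a b, ‖φ' s‖ ≤ β' s)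
    {τ : ℝ} (hτ : τ ∈ Icc a b) : ‖φ τ - φ a‖ ≤ β τ - β a :=
  image_norm_le_of_norm_deriv_right_le_deriv_boundary'
    (f := fun s => φ s - φ a) (B := fun s => β s - β a)
    (fun s hs => ((hφ s hs).sub_const _).continuousAt.continuousWithinAt)
    (fun s hs => ((hφ s (Ico_subset_Icc_self hs)).sub_const _).hasDerivWithinAt)
    (by simp)
    (fun s hs => ((hβ s hs).sub_const _).continuousAt.continuousWithinAt)
    (fun s hs => ((hβ s (Ico_subset_Icc_self hs)).sub_const _).hasDerivWithinAt)
    (fun s hs => hle s (Ico_subset_Icc_self hs)) hτ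

-- The differential inequality says that `1 / √p` is 1-Lipschitz.
theorem sqrt_mul_le_of_pos {p p' : ℝ → ℝ} (hpos : ∀ τ ∈ Icc (0 : ℝ) 1, 0 < p τ)
    (hp : ∀ τ ∈ Icc (0 : ℝ) 1, HasDerivAt p (p' τ) τ)
    (hle : ∀ τ ∈ Icc (0 : ℝ) 1, |p' τ| ≤ 2 * √(p τ) * p τ) {τ : ℝ} (hτ : τ ∈ Icc (0 : ℝ) 1) :
    √(p τ) * (1 - τ * √(p 0)) ≤ √(p 0) := by
  have hsqrt : ∀ s ∈ Icc (0 : ℝ) 1, 0 < √(p s) := fun s hs => Real.sqrt_pos.2 (hpos s hs)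
  have hder : ∀ s ∈ Icc (0 : ℝ) 1, HasDerivAt (fun s => (√(p s))⁻¹)
      (-(p' s / (2 * √(p s))) / √(p s) ^ 2) s :=
    fun s hs => ((hp s hs).sqrt (hpos s hs).ne').fun_inv (hsqrt s hs).ne'
  have hder_le : ∀ s ∈ Icc (0 : ℝ) 1, ‖-(p' s / (2 * √(p s))) / √(p s) ^ 2‖ ≤ 1 := by
    intro s hs
    have hden : 0 ≤ 2 * √(p s) * √(p s) ^ 2 := by positivity
    have h := hle s hs
    rw [neg_div, norm_neg, div_div, Real.norm_eq_abs, abs_div, abs_of_nonneg hden,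
      Real.sq_sqrt (hpos s hs).le]
    exact div_le_one_of_le₀ h ((abs_nonneg _).trans h)
  have h := (abs_le.1 (norm_sub_le_of_norm_deriv_le hder (fun s _ => hasDerivAt_id s)
    hder_le hτ)).1
  have h0 := hsqrt 0 (left_mem_Icc.2 zero_le_one)
  have h1 := hsqrt τ hτ
  simp only [id, sub_zero] at h
  have hinv : (√(p 0))⁻¹ - τ ≤ (√(p τ))⁻¹ := by linarith
  calc √(p τ) * (1 - τ * √(p 0)) = √(p τ) * √(p 0) * ((√(p 0))⁻¹ - τ) := by field_simp
    _ ≤ √(p τ) * √(p 0) * (√(p τ))⁻¹ := by gcongr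
    _ = √(p 0) := by field_simp

theorem sqrt_mul_le_of_abs_deriv_le {p p' : ℝ → ℝ} (hnonneg : ∀ τ ∈ Icc (0 : ℝ) 1, 0 ≤ p τ)
    (hp : ∀ τ ∈ Icc (0 : ℝ) 1, HasDerivAt p (p' τ) τ)
    (hle : ∀ τ ∈ Icc (0 : ℝ) 1, |p' τ| ≤ 2 * √(p τ) * p τ) {τ : ℝ} (hτ : τ ∈ Icc (0 : ℝ) 1) :
    √(p τ) * (1 - τ * √(p 0)) ≤ √(p 0) := by
  have hε : ∀ ε > 0, √(p τ + ε) * (1 - τ * √(p 0 + ε)) ≤ √(p 0 + ε) := fun ε hε =>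
    sqrt_mul_le_of_pos (p := fun s => p s + ε)
      (fun s hs => add_pos_of_nonneg_of_pos (hnonneg s hs) hε)
      (fun s hs => (hp s hs).add_const ε)
      (fun s hs => (hle s hs).trans (by have := hnonneg s hs; gcongr <;> linarith)) hτ
  have hleft : Continuous fun ε : ℝ => √(p τ + ε) * (1 - τ * √(p 0 + ε)) := by fun_prop
  have hright : Continuous fun ε : ℝ => √(p 0 + ε) := by fun_prop
  simpa using le_of_tendsto_of_tendsto
    ((hleft.tendsto 0).mono_left (nhdsWithin_le_nhds (s := Ioi 0)))
    ((hright.tendsto 0).mono_left nhdsWithin_le_nhds)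
    (eventually_of_mem self_mem_nhdsWithin hε)

theorem monotoneOn_mul_and_antitoneOn_div_of_abs_deriv_le {b b' w w' : ℝ → ℝ} {S : Set ℝ}
    (hS : Convex ℝ S) (hb : ∀ τ ∈ S, HasDerivAt b (b' τ) τ) (hw : ∀ τ ∈ S, HasDerivAt w (w' τ) τ)
    (hw0 : ∀ τ ∈ S, 0 < w τ) (hle : ∀ τ ∈ S, |b' τ| * w τ ≤ w' τ * b τ) :
    MonotoneOn (fun τ => b τ * w τ) S ∧ AntitoneOn (fun τ => b τ / w τ) S := by
  have hmul : ∀ τ ∈ S, HasDerivAt (fun τ => b τ * w τ) (b' τ * w τ + b τ * w' τ) τ :=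
    fun τ hτ => (hb τ hτ).fun_mul (hw τ hτ)
  have hdiv : ∀ τ ∈ S,
      HasDerivAt (fun τ => b τ / w τ) ((b' τ * w τ - b τ * w' τ) / w τ ^ 2) τ :=
    fun τ hτ => (hb τ hτ).fun_div (hw τ hτ) (hw0 τ hτ).ne'
  constructor
  · refine monotoneOn_of_hasDerivWithinAt_nonneg hS
      (fun τ hτ => (hmul τ hτ).continuousAt.continuousWithinAt)
      (fun τ hτ => (hmul τ (interior_subset hτ)).hasDerivWithinAt) fun τ hτ => ?_
    have hτ := interior_subset hτ
    nlinarith [hle τ hτ, mul_le_mul_of_nonneg_right (neg_le_abs (b' τ)) (hw0 τ hτ).le]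
  · refine antitoneOn_of_hasDerivWithinAt_nonpos hS
      (fun τ hτ => (hdiv τ hτ).continuousAt.continuousWithinAt)
      (fun τ hτ => (hdiv τ (interior_subset hτ)).hasDerivWithinAt) fun τ hτ => ?_
    have hτ := interior_subset hτ
    refine div_nonpos_of_nonpos_of_nonneg ?_ (sq_nonneg _)
    nlinarith [hle τ hτ, mul_le_mul_of_nonneg_right (le_abs_self (b' τ)) (hw0 τ hτ).le]

theorem hasDerivAt_one_sub_mul_pow (l τ : ℝ) (k : ℕ) :
    HasDerivAt (fun s : ℝ => (1 - s * l) ^ k) (k * (1 - τ * l) ^ (k - 1) * -l) τ := by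
  simpa using (((hasDerivAt_id τ).mul_const l).const_sub 1).fun_pow k

theorem one_sub_mul_pos {l τ : ℝ} (hl : l < 1) (hτ : τ ∈ Icc (0 : ℝ) 1) : 0 < 1 - τ * l := by
  rcases le_total l 0 with h | h
  · nlinarith [hτ.1]
  · nlinarith [hτ.2]

theorem bounds_of_abs_deriv_le_two_mul_div {b b' : ℝ → ℝ} {l : ℝ} (hl : l < 1)
    (hb : ∀ τ ∈ Icc (0 : ℝ) 1, HasDerivAt b (b' τ) τ)
    (hle : ∀ τ ∈ Icc (0 : ℝ) 1, |b' τ| ≤ 2 * (l / (1 - τ * l)) * b τ)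
    {τ : ℝ} (hτ : τ ∈ Icc (0 : ℝ) 1) :
    b τ * (1 - τ * l) ^ 2 ≤ b 0 ∧ b 0 * (1 - τ * l) ^ 2 ≤ b τ := by
  have hden : ∀ s ∈ Icc (0 : ℝ) 1, 0 < 1 - s * l := fun s hs => one_sub_mul_pos hl hs
  have hw : ∀ s ∈ Icc (0 : ℝ) 1,
      HasDerivAt (fun s : ℝ => ((1 - s * l) ^ 2)⁻¹) (2 * l / (1 - s * l) ^ 3) s := fun s hs => by
    have hd := (hden s hs).ne'
    refine ((hasDerivAt_one_sub_mul_pow l s 2).fun_inv (pow_ne_zero 2 hd)).congr_deriv ?_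
    field_simp
    push_cast
    ring
  obtain ⟨hmono, hanti⟩ := monotoneOn_mul_and_antitoneOn_div_of_abs_deriv_le (convex_Icc 0 1) hb hw
    (fun s hs => by have := hden s hs; positivity) (fun s hs => by
      have hd := hden s hs
      calc |b' s| * ((1 - s * l) ^ 2)⁻¹
          ≤ 2 * (l / (1 - s * l)) * b s * ((1 - s * l) ^ 2)⁻¹ := by gcongr; exact hle s hs
        _ = 2 * l / (1 - s * l) ^ 3 * b s := by field_simp)
  have h0 : (0 : ℝ) ∈ Icc (0 : ℝ) 1 := left_mem_Icc.2 zero_le_one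
  have hlow := hmono h0 hτ hτ.1
  have hupp := hanti h0 hτ hτ.1
  have hd := hden τ hτ
  simp only [zero_mul, sub_zero, one_pow, inv_one, mul_one, div_one, div_inv_eq_mul,
    ← div_eq_mul_inv] at hlow hupp
  exact ⟨hupp, (le_div_iff₀ (by positivity)).1 hlow⟩

theorem abs_sub_sub_deriv_le {ψ ψ₁ ψ₂ : ℝ → ℝ} {l m : ℝ} (hl : l < 1)
    (hψ : ∀ τ ∈ Icc (0 : ℝ) 1, HasDerivAt ψ (ψ₁ τ) τ)
    (hψ₁ : ∀ τ ∈ Icc (0 : ℝ) 1, HasDerivAt ψ₁ (ψ₂ τ) τ)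
    (hle : ∀ τ ∈ Icc (0 : ℝ) 1, |ψ₂ τ| ≤ 2 * m / (1 - τ * l) ^ 3) :
    |ψ 1 - ψ 0 - ψ₁ 1| ≤ m / (1 - l) ^ 2 := by
  have hφ : ∀ s ∈ Icc (0 : ℝ) 1, HasDerivAt (fun s => ψ s - s * ψ₁ s) (-(s * ψ₂ s)) s :=
    fun s hs => ((hψ s hs).fun_sub ((hasDerivAt_id' s).fun_mul (hψ₁ s hs))).congr_deriv (by ring)
  have hβ : ∀ s ∈ Icc (0 : ℝ) 1, HasDerivAt (fun s => m * s ^ 2 / (1 - s * l) ^ 2)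
      (s * (2 * m / (1 - s * l) ^ 3)) s := fun s hs => by
    have hd := (one_sub_mul_pos hl hs).ne'
    refine (((hasDerivAt_pow 2 s).const_mul m).fun_div (hasDerivAt_one_sub_mul_pow l s 2)
      (pow_ne_zero 2 hd)).congr_deriv ?_
    field_simp
    push_cast
    ring
  have h := norm_sub_le_of_norm_deriv_le hφ hβ (fun s hs => by
    rw [norm_neg, norm_mul, Real.norm_of_nonneg hs.1]
    exact mul_le_mul_of_nonneg_left (hle s hs) hs.1) (right_mem_Icc.2 zero_le_one)
  simpa [sub_right_comm] using h

end DifferentialInequalities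

section LineDerivatives

variable {E G : Type*} [NormedAddCommGroup E] [NormedSpace ℝ E] [NormedAddCommGroup G]
  [NormedSpace ℝ G] {x v : E} {τ : ℝ}

theorem hasDerivAt_comp_line {φ : E → G} (hφ : DifferentiableAt ℝ φ (x + τ • v)) :
    HasDerivAt (fun s : ℝ => φ (x + s • v)) (fderiv ℝ φ (x + τ • v) v) τ := by
  have hline : HasDerivAt (fun s : ℝ => x + s • v) v τ := by
    simpa using ((hasDerivAt_id τ).smul_const v).const_add x
  exact hφ.hasFDerivAt.comp_hasDerivAt τ hline

theorem hasDerivAt_clm_apply_comp_line {φ : E → E →L[ℝ] G}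
    (hφ : DifferentiableAt ℝ φ (x + τ • v)) (u : E) :
    HasDerivAt (fun s : ℝ => φ (x + s • v) u) (fderiv ℝ φ (x + τ • v) v u) τ := by
  simpa using (hasDerivAt_comp_line hφ).clm_apply (hasDerivAt_const τ u)

end LineDerivatives

section LocalNorms

variable {n : ℕ} {D : Set (EuclideanSpace ℝ (Fin n))} {f : EuclideanSpace ℝ (Fin n) → ℝ}
  {x h v : EuclideanSpace ℝ (Fin n)} {τ : ℝ}

/-- The third derivative as a trilinear form: `thirdDeriv f x u v w = D³f(x)[u, v, w]`. -/
noncomputable def thirdDeriv (f : EuclideanSpace ℝ (Fin n) → ℝ) (x : EuclideanSpace ℝ (Fin n)) :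
    EuclideanSpace ℝ (Fin n) →L[ℝ] EuclideanSpace ℝ (Fin n) →L[ℝ]
      EuclideanSpace ℝ (Fin n) →L[ℝ] ℝ :=
  fderiv ℝ (hess f) x

theorem localNorm_nonneg : 0 ≤ localNorm f x v :=
  Real.sqrt_nonneg _

namespace IsSelfConcordant

theorem contDiffAt (hf : IsSelfConcordant D f) (hx : x ∈ D) : ContDiffAt ℝ 3 f x :=
  hf.contDiffOn.contDiffAt (hf.isOpen.mem_nhds hx)

theorem contDiffAt_fderiv (hf : IsSelfConcordant D f) (hx : x ∈ D) :
    ContDiffAt ℝ 2 (fderiv ℝ f) x :=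
  (hf.contDiffAt hx).fderiv_right (by norm_num)

theorem contDiffAt_hess (hf : IsSelfConcordant D f) (hx : x ∈ D) : ContDiffAt ℝ 1 (hess f) x :=
  (hf.contDiffAt_fderiv hx).fderiv_right (by norm_num)

theorem differentiableAt (hf : IsSelfConcordant D f) (hx : x ∈ D) : DifferentiableAt ℝ f x :=
  (hf.contDiffAt hx).differentiableAt (by norm_num)

theorem hasDerivAt_fderiv_line (hf : IsSelfConcordant D f) (hx : x + τ • v ∈ D)
    (u : EuclideanSpace ℝ (Fin n)) :
    HasDerivAt (fun s : ℝ => fderiv ℝ f (x + s • v) u) (hess f (x + τ • v) v u) τ :=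
  hasDerivAt_clm_apply_comp_line ((hf.contDiffAt_fderiv hx).differentiableAt (by norm_num)) u

theorem hasDerivAt_hess_line (hf : IsSelfConcordant D f) (hx : x + τ • v ∈ D)
    (u w : EuclideanSpace ℝ (Fin n)) :
    HasDerivAt (fun s : ℝ => hess f (x + s • v) u w) (thirdDeriv f (x + τ • v) v u w) τ := by
  have hd := (hf.contDiffAt_hess hx).differentiableAt (by norm_num)
  simpa [thirdDeriv] using (hasDerivAt_clm_apply_comp_line hd u).clm_apply (hasDerivAt_const τ w)

theorem eventually_line_mem (hf : IsSelfConcordant D f) (hx : x + τ • v ∈ D) :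
    ∀ᶠ s in 𝓝 τ, x + s • v ∈ D :=
  ContinuousAt.eventually_mem (by fun_prop) (hf.isOpen.mem_nhds hx)

theorem hess_symm (hf : IsSelfConcordant D f) (hx : x ∈ D) (u v : EuclideanSpace ℝ (Fin n)) :
    hess f x u v = hess f x v u :=
  (hf.contDiffAt hx).isSymmSndFDerivAt (by simp; norm_num) u v

theorem thirdDeriv_swap_left (hf : IsSelfConcordant D f) (hx : x ∈ D)
    (u v w : EuclideanSpace ℝ (Fin n)) : thirdDeriv f x u v w = thirdDeriv f x v u w :=
  congrArg (· w) ((hf.contDiffAt_fderiv hx).isSymmSndFDerivAt (by simp) u v)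

theorem thirdDeriv_swap_right (hf : IsSelfConcordant D f) (hx : x ∈ D)
    (u v w : EuclideanSpace ℝ (Fin n)) : thirdDeriv f x u v w = thirdDeriv f x u w v := by
  have hx0 : x + (0 : ℝ) • u ∈ D := by simpa using hx
  have hvw := hf.hasDerivAt_hess_line hx0 v w
  have hwv := (hf.hasDerivAt_hess_line hx0 w v).congr_of_eventuallyEq
    ((hf.eventually_line_mem hx0).mono fun s hs => hf.hess_symm hs v w)
  simpa using hvw.unique hwv

theorem deriv_line_eventuallyEq (hf : IsSelfConcordant D f) (hx : x + τ • v ∈ D) :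
    deriv (fun s : ℝ => f (x + s • v)) =ᶠ[𝓝 τ] fun s => fderiv ℝ f (x + s • v) v :=
  (hf.eventually_line_mem hx).mono fun _ hs => (hasDerivAt_comp_line (hf.differentiableAt hs)).deriv

theorem iteratedDeriv_two_line_eventuallyEq (hf : IsSelfConcordant D f) (hx : x + τ • v ∈ D) :
    iteratedDeriv 2 (fun s : ℝ => f (x + s • v)) =ᶠ[𝓝 τ] fun s => hess f (x + s • v) v v := by
  filter_upwards [hf.eventually_line_mem hx] with s hs
  rw [iteratedDeriv_succ, iteratedDeriv_one, (hf.deriv_line_eventuallyEq hs).deriv_eq]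
  exact (hf.hasDerivAt_fderiv_line hs v).deriv

theorem iteratedDeriv_three_line (hf : IsSelfConcordant D f) (hx : x + τ • v ∈ D) :
    iteratedDeriv 3 (fun s : ℝ => f (x + s • v)) τ = thirdDeriv f (x + τ • v) v v v := by
  rw [iteratedDeriv_succ, (hf.iteratedDeriv_two_line_eventuallyEq hx).deriv_eq]
  exact (hf.hasDerivAt_hess_line hx v v).deriv

theorem hess_nonneg (hf : IsSelfConcordant D f) (hx : x ∈ D) (v : EuclideanSpace ℝ (Fin n)) :
    0 ≤ hess f x v v := by
  have hx0 : x + (0 : ℝ) • v ∈ D := by simpa using hx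
  have hopen : IsOpen {τ : ℝ | x + τ • v ∈ D} :=
    hf.isOpen.preimage (by fun_prop : Continuous fun τ : ℝ => x + τ • v)
  have hmono := (hf.line x hx v).convexOn.monotoneOn_deriv
    fun τ hτ => (hasDerivAt_comp_line (hf.differentiableAt hτ)).differentiableAt
  have hderiv := hmono.derivWithin_nonneg (x := 0)
  rw [derivWithin_of_isOpen hopen hx0, (hf.deriv_line_eventuallyEq hx0).deriv_eq,
    (hf.hasDerivAt_fderiv_line hx0 v).deriv] at hderiv
  simpa using hderiv

theorem localNorm_sq (hf : IsSelfConcordant D f) (hx : x ∈ D) (v : EuclideanSpace ℝ (Fin n)) :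
    localNorm f x v ^ 2 = hess f x v v :=
  Real.sq_sqrt (hf.hess_nonneg hx v)

theorem abs_thirdDeriv_diag_le (hf : IsSelfConcordant D f) (hx : x ∈ D)
    (v : EuclideanSpace ℝ (Fin n)) :
    |thirdDeriv f x v v v| ≤ 2 * √(hess f x v v) ^ 3 := by
  have hx0 : x + (0 : ℝ) • v ∈ D := by simpa using hx
  have hbound := (hf.line x hx v).bound 0 hx0
  rw [hf.iteratedDeriv_three_line hx0,
    (hf.iteratedDeriv_two_line_eventuallyEq hx0).eq_of_nhds] at hbound
  simp only [zero_smul, add_zero] at hbound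
  rwa [Real.rpow_div_two_eq_sqrt _ (hf.hess_nonneg hx v), Real.rpow_ofNat] at hbound

theorem abs_thirdDeriv_le (hf : IsSelfConcordant D f) (hx : x ∈ D)
    (u v : EuclideanSpace ℝ (Fin n)) :
    |thirdDeriv f x u v v| ≤ 2 * localNorm f x u * hess f x v v := by
  have hT : IsSymmTrilinear
      ((thirdDeriv f x).toLinearMap₁₂.compr₂ (ContinuousLinearMap.coeLM ℝ)) :=
    ⟨hf.thirdDeriv_swap_left hx, hf.thirdDeriv_swap_right hx⟩
  have hB : (hess f x).toBilinForm.IsPosSemidef := ⟨⟨hf.hess_symm hx⟩, ⟨hf.hess_nonneg hx⟩⟩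
  exact hT.abs_apply_le hB zero_le_two (hf.abs_thirdDeriv_diag_le hx) u v

theorem localNorm_line_mul_le (hf : IsSelfConcordant D f) (hx : x ∈ D) (hxh : x + h ∈ D)
    (hτ : τ ∈ Icc (0 : ℝ) 1) :
    localNorm f (x + τ • h) h * (1 - τ * localNorm f x h) ≤ localNorm f x h := by
  have hmem : ∀ s ∈ Icc (0 : ℝ) 1, x + s • h ∈ D :=
    fun s hs => hf.convexOn.1.add_smul_mem hx hxh hs
  simpa [localNorm] using sqrt_mul_le_of_abs_deriv_le
    (fun s hs => hf.hess_nonneg (hmem s hs) h)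
    (fun s hs => hf.hasDerivAt_hess_line (hmem s hs) h h)
    (fun s hs => hf.abs_thirdDeriv_le (hmem s hs) h h) hτ

theorem localNorm_compare (hf : IsSelfConcordant D f) (hx : x ∈ D) (hxh : x + h ∈ D)
    (hl : localNorm f x h < 1) (d : EuclideanSpace ℝ (Fin n)) (hτ : τ ∈ Icc (0 : ℝ) 1) :
    localNorm f (x + τ • h) d * (1 - τ * localNorm f x h) ≤ localNorm f x d ∧
      localNorm f x d * (1 - τ * localNorm f x h) ≤ localNorm f (x + τ • h) d := by
  have hmem : ∀ s ∈ Icc (0 : ℝ) 1, x + s • h ∈ D :=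
    fun s hs => hf.convexOn.1.add_smul_mem hx hxh hs
  have hbounds := bounds_of_abs_deriv_le_two_mul_div hl
    (fun s hs => hf.hasDerivAt_hess_line (hmem s hs) d d)
    (fun s hs => (hf.abs_thirdDeriv_le (hmem s hs) h d).trans (by
      have := hf.hess_nonneg (hmem s hs) d
      gcongr
      exact (le_div_iff₀ (one_sub_mul_pos hl hs)).2 (hf.localNorm_line_mul_le hx hxh hs))) hτ
  simp only [zero_smul, add_zero] at hbounds
  rw [← hf.localNorm_sq hx, ← hf.localNorm_sq (hmem τ hτ), ← mul_pow, ← mul_pow] at hbounds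
  exact hbounds.imp (le_of_sq_le_sq · localNorm_nonneg) (le_of_sq_le_sq · localNorm_nonneg)

theorem abs_fderiv_sub_sub_hess_le (hf : IsSelfConcordant D f) (hx : x ∈ D) (hxh : x + h ∈ D)
    (hl : localNorm f x h < 1) (d : EuclideanSpace ℝ (Fin n)) :
    |fderiv ℝ f (x + h) d - fderiv ℝ f x d - hess f (x + h) h d| ≤
      localNorm f x h ^ 2 * localNorm f x d / (1 - localNorm f x h) ^ 2 := by
  have hmem : ∀ s ∈ Icc (0 : ℝ) 1, x + s • h ∈ D :=
    fun s hs => hf.convexOn.1.add_smul_mem hx hxh hs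
  have hthird : ∀ s ∈ Icc (0 : ℝ) 1, |thirdDeriv f (x + s • h) h h d| ≤
      2 * (localNorm f x h ^ 2 * localNorm f x d) / (1 - s * localNorm f x h) ^ 3 := fun s hs => by
    have hden := one_sub_mul_pos hl hs
    have hh := (le_div_iff₀ hden).2 (hf.localNorm_line_mul_le hx hxh hs)
    have hd := (le_div_iff₀ hden).2 (hf.localNorm_compare hx hxh hl d hs).1
    have hh0 : 0 ≤ localNorm f (x + s • h) h := localNorm_nonneg
    have hd0 : 0 ≤ localNorm f x d := localNorm_nonneg
    calc |thirdDeriv f (x + s • h) h h d|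
        = |thirdDeriv f (x + s • h) d h h| := by
          rw [hf.thirdDeriv_swap_right (hmem s hs), hf.thirdDeriv_swap_left (hmem s hs)]
      _ ≤ 2 * localNorm f (x + s • h) d * localNorm f (x + s • h) h ^ 2 := by
          rw [hf.localNorm_sq (hmem s hs)]
          exact hf.abs_thirdDeriv_le (hmem s hs) d h
      _ ≤ 2 * (localNorm f x d / (1 - s * localNorm f x h)) *
            (localNorm f x h / (1 - s * localNorm f x h)) ^ 2 := by gcongr
      _ = _ := by field_simp
  simpa using abs_sub_sub_deriv_le hl
    (fun s hs => hf.hasDerivAt_fderiv_line (hmem s hs) d)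
    (fun s hs => hf.hasDerivAt_hess_line (hmem s hs) h d) hthird

end IsSelfConcordant

end LocalNorms

section ProximalNewtonStep

theorem zero_le_add_sub_of_isMinOn_add {E : Type*} [NormedAddCommGroup E] [NormedSpace ℝ E]
    {f φ : E → ℝ} {f' : E →L[ℝ] ℝ} {S : Set E} {x y : E} (hf : HasFDerivAt f f' x)
    (hφ : ConvexOn ℝ S φ) (hmin : IsMinOn (fun y => f y + φ y) S x) (hx : x ∈ S) (hy : y ∈ S) :
    0 ≤ f' (y - x) + (φ y - φ x) := by
  set ψ : ℝ → ℝ := fun s => f (x + s • (y - x)) + s * (φ y - φ x) with hψ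
  have hψ_min : IsMinOn ψ (Icc 0 1) 0 := fun s hs => by
    have hconv := hφ.2 hx hy (sub_nonneg.2 hs.2) hs.1 (sub_add_cancel 1 s)
    rw [show (1 - s) • x + s • y = x + s • (y - x) by module] at hconv
    have hle : f x + φ x ≤ f (x + s • (y - x)) + φ (x + s • (y - x)) :=
      hmin (hφ.1.add_smul_sub_mem hx hy hs)
    simp only [smul_eq_mul] at hconv
    simp only [hψ, mem_ofPred_eq, zero_smul, add_zero, zero_mul]
    linarith
  have hline : HasDerivAt (fun s : ℝ => f (x + s • (y - x))) (f' (y - x)) 0 :=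
    hf.hasLineDerivAt (y - x)
  have hψ' : HasDerivAt ψ (f' (y - x) + (φ y - φ x)) 0 := by
    simpa only [one_mul] using hline.fun_add ((hasDerivAt_id' 0).mul_const (φ y - φ x))
  have hcone : (1 : ℝ) - 0 ∈ posTangentConeAt (Icc (0 : ℝ) 1) 0 :=
    sub_mem_posTangentConeAt_of_segment_subset (segment_eq_Icc zero_le_one).subset
  simpa using hψ_min.localize.hasFDerivWithinAt_nonneg hψ'.hasFDerivAt.hasFDerivWithinAt hcone

variable {n : ℕ} {D S : Set (EuclideanSpace ℝ (Fin n))} {f φ : EuclideanSpace ℝ (Fin n) → ℝ}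
  {xstar x y z : EuclideanSpace ℝ (Fin n)} {δ : ℝ}

/-- `x` is the result of an inexact full proximal-Newton step from `z` for the minimization of
`f + φ` over `S`: it minimizes the model `Q(·; z) + φ` over `S` up to the error `δ² / 2`. In the
composite problem `S = dom F` and `φ = t⁻¹ g`; here `φ` is real-valued and only matters on `S`. -/
def IsInexactProxNewtonStep (S : Set (EuclideanSpace ℝ (Fin n)))
    (f φ : EuclideanSpace ℝ (Fin n) → ℝ) (z : EuclideanSpace ℝ (Fin n)) (δ : ℝ)
    (x : EuclideanSpace ℝ (Fin n)) : Prop :=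
  x ∈ S ∧ ∀ y ∈ S, Q f z x + φ x - (Q f z y + φ y) ≤ δ ^ 2 / 2

theorem Q_add_smul (hsymm : ∀ u v, hess f z u v = hess f z v u) (x v : EuclideanSpace ℝ (Fin n))
    (s : ℝ) :
    Q f z (x + s • v) =
      Q f z x + s * (fderiv ℝ f z v + hess f z (x - z) v) + s ^ 2 / 2 * hess f z v v := by
  rw [Q, Q, show x + s • v - z = (x - z) + s • v by abel]
  simp only [map_add, map_smul, add_apply, smul_apply, smul_eq_mul, hsymm v (x - z)]
  ring

theorem IsInexactProxNewtonStep.mul_model_slope_le (hx : IsInexactProxNewtonStep S f φ z δ x)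
    (hφ : ConvexOn ℝ S φ) (hsymm : ∀ u v, hess f z u v = hess f z v u) (hy : y ∈ S) {s : ℝ}
    (hs : s ∈ Icc (0 : ℝ) 1) :
    s * (fderiv ℝ f z (x - y) + hess f z (x - z) (x - y) + φ x - φ y) ≤
      s ^ 2 / 2 * hess f z (x - y) (x - y) + δ ^ 2 / 2 := by
  have hmodel := hx.2 _ (hφ.1.add_smul_sub_mem hx.1 hy hs)
  have hconv := hφ.2 hx.1 hy (sub_nonneg.2 hs.2) hs.1 (sub_add_cancel 1 s)
  rw [show (1 - s) • x + s • y = x + s • (y - x) by module] at hconv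
  rw [Q_add_smul hsymm, ← neg_sub x y] at hmodel
  simp only [smul_eq_mul, ← neg_sub x y, map_neg, neg_apply, neg_neg] at hmodel hconv
  linarith

theorem le_add_of_forall_mul_le {a R δ : ℝ} (hR : 0 ≤ R) (hδ : 0 ≤ δ)
    (h : ∀ s ∈ Icc (0 : ℝ) 1, s * (a ^ 2 - R * a) ≤ s ^ 2 / 2 * a ^ 2 + δ ^ 2 / 2) :
    a ≤ R + δ := by
  rcases le_or_gt a R with haR | haR
  · exact haR.trans (le_add_of_nonneg_right hδ)
  · have ha : 0 < a := hR.trans_lt haR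
    have hs : (a - R) / a ∈ Icc (0 : ℝ) 1 :=
      ⟨div_nonneg (sub_pos.2 haR).le ha.le, (div_le_one ha).2 (sub_le_self a hR)⟩
    have hlhs : (a - R) / a * (a ^ 2 - R * a) = (a - R) ^ 2 := by field_simp
    have hrhs : ((a - R) / a) ^ 2 / 2 * a ^ 2 = (a - R) ^ 2 / 2 := by field_simp
    have hoptimal := h _ hs
    rw [hlhs, hrhs] at hoptimal
    exact sub_le_iff_le_add'.1 (le_of_sq_le_sq (by linarith) hδ)

theorem IsInexactProxNewtonStep.localNorm_sub_le_add_of_gradient_error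
    (hx : IsInexactProxNewtonStep S f φ z δ x) (hf : IsSelfConcordant D f) (hSD : S ⊆ D)
    (hφ : ConvexOn ℝ S φ) (hstar : xstar ∈ S)
    (hmin : IsMinOn (fun y => f y + φ y) S xstar) (hz : z ∈ D) (hδ : 0 ≤ δ) {R : ℝ} (hR : 0 ≤ R)
    (herr : |fderiv ℝ f z (x - xstar) - fderiv ℝ f xstar (x - xstar) -
      hess f z (z - xstar) (x - xstar)| ≤ R * localNorm f z (x - xstar)) :
    localNorm f z (x - xstar) ≤ R + δ := by
  have hoptimal : 0 ≤ fderiv ℝ f xstar (x - xstar) + (φ x - φ xstar) :=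
    zero_le_add_sub_of_isMinOn_add (hf.differentiableAt (hSD hstar)).hasFDerivAt hφ hmin hstar hx.1
  have hsplit : hess f z (x - z) (x - xstar) =
      hess f z (x - xstar) (x - xstar) - hess f z (z - xstar) (x - xstar) := by
    rw [← sub_apply, ← map_sub, sub_sub_sub_cancel_right]
  have hslope : localNorm f z (x - xstar) ^ 2 - R * localNorm f z (x - xstar) ≤
      fderiv ℝ f z (x - xstar) + hess f z (x - z) (x - xstar) + φ x - φ xstar := by
    rw [hf.localNorm_sq hz, hsplit]
    linarith [(abs_le.1 herr).1]
  refine le_add_of_forall_mul_le hR hδ fun s hs => ?_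
  calc s * (localNorm f z (x - xstar) ^ 2 - R * localNorm f z (x - xstar))
      ≤ s * (fderiv ℝ f z (x - xstar) + hess f z (x - z) (x - xstar) + φ x - φ xstar) :=
        mul_le_mul_of_nonneg_left hslope hs.1
    _ ≤ s ^ 2 / 2 * hess f z (x - xstar) (x - xstar) + δ ^ 2 / 2 :=
        hx.mul_model_slope_le hφ (hf.hess_symm hz) hstar hs
    _ = s ^ 2 / 2 * localNorm f z (x - xstar) ^ 2 + δ ^ 2 / 2 := by rw [hf.localNorm_sq hz]

theorem IsInexactProxNewtonStep.localNorm_sub_le (hx : IsInexactProxNewtonStep S f φ z δ x)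
    (hf : IsSelfConcordant D f) (hSD : S ⊆ D) (hφ : ConvexOn ℝ S φ) (hstar : xstar ∈ S)
    (hmin : IsMinOn (fun y => f y + φ y) S xstar) (hz : z ∈ D) (hδ : 0 ≤ δ)
    (hl : localNorm f xstar (z - xstar) < 1) :
    localNorm f xstar (x - xstar) ≤
      localNorm f xstar (z - xstar) ^ 2 / (1 - localNorm f xstar (z - xstar)) ^ 4 +
        δ / (1 - localNorm f xstar (z - xstar)) := by
  have hxs : xstar ∈ D := hSD hstar
  have hzs : xstar + (z - xstar) ∈ D := by rwa [add_sub_cancel]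
  have hgrad := hf.abs_fderiv_sub_sub_hess_le hxs hzs hl (x - xstar)
  have hcompare := (hf.localNorm_compare hxs hzs hl (x - xstar) (right_mem_Icc.2 zero_le_one)).2
  rw [one_smul, one_mul] at hcompare
  rw [add_sub_cancel] at hgrad hcompare
  set l := localNorm f xstar (z - xstar)
  have hl0 : 0 < 1 - l := sub_pos.2 hl
  have hchange := (le_div_iff₀ hl0).2 hcompare
  have hdual : |fderiv ℝ f z (x - xstar) - fderiv ℝ f xstar (x - xstar) -
      hess f z (z - xstar) (x - xstar)| ≤ l ^ 2 / (1 - l) ^ 3 * localNorm f z (x - xstar) :=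
    calc _ ≤ l ^ 2 * localNorm f xstar (x - xstar) / (1 - l) ^ 2 := hgrad
      _ ≤ l ^ 2 * (localNorm f z (x - xstar) / (1 - l)) / (1 - l) ^ 2 := by gcongr
      _ = l ^ 2 / (1 - l) ^ 3 * localNorm f z (x - xstar) := by field_simp
  calc localNorm f xstar (x - xstar) ≤ localNorm f z (x - xstar) / (1 - l) := hchange
    _ ≤ (l ^ 2 / (1 - l) ^ 3 + δ) / (1 - l) := by
      gcongr
      exact hx.localNorm_sub_le_add_of_gradient_error hf hSD hφ hstar hmin hz hδ
        (by positivity) hdual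
    _ = l ^ 2 / (1 - l) ^ 4 + δ / (1 - l) := by field_simp

theorem sq_div_one_sub_pow_four_add_div_le {l δ : ℝ} (hl : l ≤ 0.15) (hδ : 0 ≤ δ) :
    l ^ 2 / (1 - l) ^ 4 + δ / (1 - l) ≤ 1.98 * l ^ 2 + 1.177 * δ := by
  have hden : (0.85 : ℝ) ≤ 1 - l := by linarith
  have hden4 : (0.85 : ℝ) ^ 4 ≤ (1 - l) ^ 4 := by gcongr
  have hpos : 0 < 1 - l := by linarith
  refine add_le_add ?_ ?_
  · rw [div_le_iff₀ (by positivity)]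
    nlinarith [sq_nonneg l]
  · rw [div_le_iff₀ hpos]
    nlinarith

end ProximalNewtonStep

section Convergence

variable {lam : ℕ → ℝ} {r : ℝ}

theorem tendsto_zero_and_le_mul {q : ℝ} (hlam : ∀ j, 0 ≤ lam j) (hq0 : 0 ≤ q) (hq1 : q < 1)
    (hrec : ∀ j, lam j ≤ r → lam (j + 1) ≤ q * lam j) (h0 : lam 0 ≤ r) :
    Tendsto lam atTop (𝓝 0) ∧ ∀ j, lam j ≤ r ∧ lam (j + 1) ≤ q * lam j := by
  have hr : ∀ j, lam j ≤ r := fun j => by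
    induction j with
    | zero => exact h0
    | succ j ih => exact (hrec j ih).trans ((mul_le_of_le_one_left (hlam j) hq1.le).trans ih)
  have hle : ∀ j, lam j ≤ q ^ j * lam 0 := fun j => by
    induction j with
    | zero => simp
    | succ j ih =>
      calc lam (j + 1) ≤ q * lam j := hrec j (hr j)
        _ ≤ q * (q ^ j * lam 0) := by gcongr
        _ = q ^ (j + 1) * lam 0 := by ring
  exact ⟨squeeze_zero hlam hle
    (by simpa using (tendsto_pow_atTop_nhds_zero_of_lt_one hq0 hq1).mul_const (lam 0)),
    fun j => ⟨hr j, hrec j (hr j)⟩⟩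

theorem tendsto_zero_and_le_mul_sq {K₀ K : ℝ} (hlam : ∀ j, 0 ≤ lam j) (hK₀ : 0 ≤ K₀) (hK : K₀ < K)
    (hrec : ∀ j, lam j ≤ r → lam (j + 1) ≤ K₀ * lam j ^ 2) (h0 : lam 0 ≤ min r K⁻¹) :
    Tendsto lam atTop (𝓝 0) ∧ ∀ j, lam (j + 1) ≤ K * lam j ^ 2 := by
  have hKpos : 0 < K := hK₀.trans_lt hK
  have hlinear : ∀ j, lam j ≤ min r K⁻¹ → lam (j + 1) ≤ K₀ / K * lam j := fun j hj => by
    have hj0 := hlam j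
    calc lam (j + 1) ≤ K₀ * lam j ^ 2 := hrec j (hj.trans (min_le_left _ _))
      _ = K₀ * lam j * lam j := by ring
      _ ≤ K₀ * K⁻¹ * lam j := by gcongr; exact hj.trans (min_le_right _ _)
      _ = K₀ / K * lam j := by rw [div_eq_mul_inv]
  obtain ⟨hlim, hbound⟩ := tendsto_zero_and_le_mul hlam (by positivity) ((div_lt_one hKpos).2 hK)
    hlinear h0
  exact ⟨hlim, fun j => (hrec j ((hbound j).1.trans (min_le_left _ _))).trans
    (mul_le_mul_of_nonneg_right hK.le (sq_nonneg _))⟩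

theorem isCoercive_of_pos {V : Type*} [NormedAddCommGroup V] [NormedSpace ℝ V]
    [FiniteDimensional ℝ V] {B : V →L[ℝ] V →L[ℝ] ℝ} (hpos : ∀ u, u ≠ 0 → 0 < B u u) :
    IsCoercive B := by
  have : ProperSpace V := FiniteDimensional.proper ℝ V
  rcases subsingleton_or_nontrivial V with hV | hV
  · exact ⟨1, one_pos, fun u => by simp [Subsingleton.elim u 0]⟩
  obtain ⟨w, hw, hmin⟩ := (isCompact_sphere (0 : V) 1).exists_isMinOn
    (NormedSpace.sphere_nonempty.2 zero_le_one)
    (by fun_prop : Continuous fun u => B u u).continuousOn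
  refine ⟨B w w, hpos w (ne_zero_of_mem_unit_sphere ⟨w, hw⟩), fun u => ?_⟩
  rcases eq_or_ne u 0 with rfl | hu
  · simp
  have hmin_u : B w w ≤ B (‖u‖⁻¹ • u) (‖u‖⁻¹ • u) :=
    hmin (mem_sphere_zero_iff_norm.2 (norm_smul_inv_norm hu))
  simp only [map_smul, smul_apply, smul_eq_mul] at hmin_u
  have := norm_ne_zero_iff.2 hu
  calc B w w * ‖u‖ * ‖u‖ ≤ ‖u‖⁻¹ * (‖u‖⁻¹ * B u u) * ‖u‖ * ‖u‖ := by gcongr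
    _ = B u u := by field_simp

theorem tendsto_of_tendsto_localNorm {n : ℕ} {f : EuclideanSpace ℝ (Fin n) → ℝ}
    {xstar : EuclideanSpace ℝ (Fin n)} {ι : Type*} {L : Filter ι}
    {x : ι → EuclideanSpace ℝ (Fin n)} (hpos : ∀ u, u ≠ 0 → 0 < hess f xstar u u)
    (hlim : Tendsto (fun j => localNorm f xstar (x j - xstar)) L (𝓝 0)) :
    Tendsto x L (𝓝 xstar) := by
  obtain ⟨C, hC, hle⟩ := isCoercive_of_pos hpos
  have hnorm : ∀ j, ‖x j - xstar‖ ≤ (√C)⁻¹ * localNorm f xstar (x j - xstar) := fun j => by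
    rw [le_inv_mul_iff₀ (Real.sqrt_pos.2 hC), localNorm]
    refine Real.le_sqrt_of_sq_le ?_
    rw [mul_pow, Real.sq_sqrt hC.le, sq, ← mul_assoc]
    exact hle _
  rw [tendsto_iff_norm_sub_tendsto_zero]
  exact squeeze_zero (fun _ => norm_nonneg _) hnorm (by simpa using hlim.const_mul (√C)⁻¹)

end Convergence

theorem IsProperLscConvex.convexOn_toReal {n : ℕ} {g : EuclideanSpace ℝ (Fin n) → EReal}
    (hg : IsProperLscConvex g) : ConvexOn ℝ {x | g x < ⊤} fun x => (g x).toReal := by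
  refine convexOn_of_convex_epigraph ?_
  convert hg.convex using 1
  ext ⟨x, a⟩
  refine ⟨fun ⟨hx, hxa⟩ => ?_, fun hxa => ?_⟩
  · exact (EReal.le_coe_toReal hx.ne).trans (EReal.coe_le_coe_iff.2 hxa)
  · have hx : g x < ⊤ := lt_of_le_of_lt hxa (EReal.coe_lt_top a)
    exact ⟨hx, EReal.coe_le_coe_iff.1 ((EReal.coe_toReal_le (hg.ne_bot x)).trans hxa)⟩

theorem convexOn_domF {n : ℕ} {D : Set (EuclideanSpace ℝ (Fin n))}
    {g : EuclideanSpace ℝ (Fin n) → EReal} {t : ℝ} (hD : Convex ℝ D) (hg : IsProperLscConvex g)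
    (ht : 0 ≤ t) : ConvexOn ℝ (domF D g) fun x => t⁻¹ * (g x).toReal :=
  (hg.convexOn_toReal.smul (inv_nonneg.2 ht)).subset inter_subset_right
    (hD.inter hg.convexOn_toReal.1)

end ProxNewton

open Filter ProxNewton in
theorem corollary3p3_general {n : ℕ} {D S : Set (EuclideanSpace ℝ (Fin n))}
    {f φ : EuclideanSpace ℝ (Fin n) → ℝ} {xstar : EuclideanSpace ℝ (Fin n)}
    {x : ℕ → EuclideanSpace ℝ (Fin n)} {δ lam : ℕ → ℝ} (hf : IsSelfConcordant D f) (hSD : S ⊆ D)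
    (hφ : ConvexOn ℝ S φ) (hstar : xstar ∈ S) (hmin : IsMinOn (fun y => f y + φ y) S xstar)
    (hpos : ∀ u, u ≠ 0 → 0 < hess f xstar u u) (hx0 : x 0 ∈ S) (hδ : ∀ j, 0 ≤ δ j)
    (hstep : ∀ j, IsInexactProxNewtonStep S f φ (x j) (δ j) (x (j + 1)))
    (hlam : ∀ j, lam j = localNorm f xstar (x j - xstar)) :
    ((∀ j, δ j ≤ 0.15 * lam j) → lam 0 ≤ 0.15 →
      Tendsto x atTop (nhds xstar) ∧ Tendsto lam atTop (nhds 0) ∧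
        ∀ j, lam (j + 1) ≤ 1 / 2 * lam j) ∧
    ∀ c K : ℝ, 0 ≤ c → 1.177 * c + 1.98 < K → (∀ j, δ j ≤ c * lam j ^ 2) →
      lam 0 ≤ min 0.15 K⁻¹ →
      Tendsto x atTop (nhds xstar) ∧ Tendsto lam atTop (nhds 0) ∧
        ∀ j, lam (j + 1) ≤ K * lam j ^ 2 := by
  have hmem : ∀ j, x j ∈ S := fun j => j.casesOn hx0 fun k => (hstep k).1
  have hlam0 : ∀ j, 0 ≤ lam j := fun j => (hlam j).symm ▸ localNorm_nonneg
  have hrec : ∀ j, lam j ≤ 0.15 → lam (j + 1) ≤ 1.98 * lam j ^ 2 + 1.177 * δ j := fun j hj => by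
    have hlocal := (hstep j).localNorm_sub_le hf hSD hφ hstar hmin (hSD (hmem j)) (hδ j)
    rw [← hlam, ← hlam] at hlocal
    exact (hlocal (by linarith)).trans (sq_div_one_sub_pow_four_add_div_le hj (hδ j))
  have hconv : Tendsto lam atTop (nhds 0) → Tendsto x atTop (nhds xstar) := fun hlim =>
    tendsto_of_tendsto_localNorm hpos (by simpa only [← hlam] using hlim)
  refine ⟨fun hδlam h0 => ?_, fun c K hc hK hδlam h0 => ?_⟩
  · have hlinear : ∀ j, lam j ≤ 0.15 → lam (j + 1) ≤ 1 / 2 * lam j := fun j hj => by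
      nlinarith [hrec j hj, hδlam j, hlam0 j]
    obtain ⟨hlim, hrate⟩ :=
      tendsto_zero_and_le_mul hlam0 (by norm_num) (by norm_num) hlinear h0
    exact ⟨hconv hlim, hlim, fun j => (hrate j).2⟩
  · have hquadratic : ∀ j, lam j ≤ 0.15 → lam (j + 1) ≤ (1.177 * c + 1.98) * lam j ^ 2 :=
      fun j hj => by linarith [hrec j hj, hδlam j]
    obtain ⟨hlim, hrate⟩ :=
      tendsto_zero_and_le_mul_sq hlam0 (by positivity) hK hquadratic h0
    exact ⟨hconv hlim, hlim, hrate⟩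

theorem corollary3p3 :
    ∃ q : ℝ, 0 ≤ q ∧ q < 1 ∧
      ∀ (n : ℕ) (D : Set (EuclideanSpace ℝ (Fin n))) (f : EuclideanSpace ℝ (Fin n) → ℝ)
        (ν : ℝ) (g : EuclideanSpace ℝ (Fin n) → EReal) (t : ℝ)
        (xstar : EuclideanSpace ℝ (Fin n)) (x : ℕ → EuclideanSpace ℝ (Fin n)) (δ lam : ℕ → ℝ),
        ProxNewton.IsSelfConcordantBarrier D f ν →
        ProxNewton.IsProperLscConvex g →
        0 < t →
        ProxNewton.IsSolution D f g t xstar →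
        (∀ u : EuclideanSpace ℝ (Fin n), u ≠ 0 → 0 < ProxNewton.hess f xstar u u) →
        x 0 ∈ ProxNewton.domF D g →
        (∀ j, 0 ≤ δ j) →
        (∀ j, ProxNewton.IsDeltaSolution D f g t (x j) (δ j) (x (j + 1))) →
        (∀ j, lam j = ProxNewton.localNorm f xstar (x j - xstar)) →
        (((∀ j, δ j ≤ 0.15 * lam j) → lam 0 ≤ 0.1427 →
            Filter.Tendsto x Filter.atTop (nhds xstar) ∧
            Filter.Tendsto lam Filter.atTop (nhds 0) ∧
            ∀ j, lam (j + 1) ≤ q * lam j) ∧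
          (∀ c : ℝ, 0 < c → (∀ j, δ j ≤ c * lam j ^ 2) →
            lam 0 ≤ min 0.15 (1.177 * c + 6.068)⁻¹ →
            Filter.Tendsto x Filter.atTop (nhds xstar) ∧
            Filter.Tendsto lam Filter.atTop (nhds 0) ∧
            ∀ j, lam (j + 1) ≤ (1.177 * c + 6.068) * lam j ^ 2)) := by
  refine ⟨1 / 2, by norm_num, by norm_num, ?_⟩
  intro n D f ν g t xstar x δ lam hf hg ht hstar hpos hx0 hδ hstep hlam
  obtain ⟨hlinear, hquadratic⟩ := corollary3p3_general hf.selfConcordant (fun _ hy => hy.1)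
    (ProxNewton.convexOn_domF hf.selfConcordant.convexOn.1 hg ht.le) hstar.1 hstar.2 hpos hx0 hδ
    hstep hlam
  exact ⟨fun hδlam h0 => hlinear hδlam (h0.trans (by norm_num)),
    fun c hc => hquadratic c _ hc.le (by linarith)⟩
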